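/- Let $L\ge 1$ and consider a point-to-point channel with in-block memory of block length $L$ and with finite alphabets $\mathcal X_i$ (inputs, non-empty), $\mathcal Y_i$ (receiver outputs) and $\tilde{\mathcal Y}_i$ (feedback), $i=1,\dots,L$: in every block of $L$ channel uses, $$(Y_i,\tilde Y_i)=\bigl(f_i(X_1,\dots,X_i,Z),\ \tilde f_i(X_1,\dots,X_i,Z)\bigr),\qquad i=1,\dots,L,$$ where $X_1,\dots,X_i$ are the inputs of that block, $f_i,\tilde f_i$ are fixed functions, and $Z$ is a noise variable with values in an arbitrary measurable space; the noises of different blocks are independent and identically distributed and independent of the message. The feedback may be noisy, i.e. $\tilde Y^L$ need not be determined by what the receiver sees. A code for $n=mL$ channel uses ($m\ge1$) with $M$ messages consists of functions $X_t=\mathbf a_t(W,\tilde Y_1,\dots,\tilde Y_{t-1})$, $t=1,\dots,n$, where the message $W$ is uniform on $M$ values, and of a decoder $\hat W=d(Y_1,\dots,Y_n)$; its rate is $(\log_2 M)/n$. A rate $R$ is achievable if for every $\epsilon>0$ there are an $m\ge1$ and such a code of rate $R$ with $\Pr[\hat W\ne W]\le\epsilon$. The capacity region is the closure of the set of achievable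 rates, and the capacity $C$ is its supremum. Then the capacity region is the interval $[0,C]$, and $$C=\max_{P_{\mathbf A^L}}\ \frac1L\, I(\mathbf A^L;Y^L),$$ where the maximum is attained and is over all probability distributions $P_{\mathbf A^L}$ on the finite set of code trees of depth $L$, that is, of tuples $\mathbf a^L=(\mathbf a_1,\dots,\mathbf a_L)$ of functions $\mathbf a_i:\tilde{\mathcal Y}_1\times\dots\times\tilde{\mathcal Y}_{i-1}\to\mathcal X_i$. Here $I$ is mutual information in bits, and the joint distribution is $$P(\mathbf a^L,x^L,y^L,\tilde y^L)=P_{\mathbf A^L}(\mathbf a^L)\,\Bigl[\prod_{i=1}^L 1\{x_i=\mathbf a_i(\tilde y_1,\dots,\tilde y_{i-1})\}\Bigr]\,P(y^L,\tilde y^L\,\|\,x^L),$$ where $P(y^L,\tilde y^L\|x^L)$ is the probability that $f_i(x_1,\dots,x_i,Z)=y_i$ and $\tilde f_i(x_1,\dots,x_i,Z)=\tilde y_i$ for all $i=1,\dots,L$. -/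

import Mathlib

open MeasureTheory

/-- A point-to-point channel with in-block memory and block length `L`. The alphabets may depend on
the position `i` inside the block: inputs `X i`, receiver outputs `Y i`, feedback `F i`. The noise
of one block is a random variable with values in an arbitrary measurable space `Z`. The receiver
output and the feedback at position `i` are functions of the inputs at positions `≤ i` of the same
block and of the noise of that block. -/
structure PtpChannel {L : ℕ} (X Y F : Fin L → Type*) (Z : Type*) [MeasurableSpace Z] where
  /-- the law of the noise of one block -/
  noise : ProbabilityMeasure Z
  /-- the receiver output at position `i` -/
  out : ∀ i : Fin L, ((j : Set.Iic i) → X j) → Z → Y i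
  /-- the feedback letter at position `i` -/
  fb : ∀ i : Fin L, ((j : Set.Iic i) → X j) → Z → F i
  measurableSet_out : ∀ i x y, MeasurableSet {z | out i x z = y}
  measurableSet_fb : ∀ i x y, MeasurableSet {z | fb i x z = y}

/-- Code trees of depth `L`: the letter at position `i` is a function of the feedback letters at
the earlier positions. -/
def CodeTree {L : ℕ} (X F : Fin L → Type*) : Type _ :=
  ∀ i : Fin L, ((j : Set.Iio i) → F j) → X i

noncomputable instance CodeTree.instFintype {L : ℕ} (X F : Fin L → Type*)
    [∀ i, Fintype (X i)] [∀ i, Fintype (F i)] : Fintype (CodeTree X F) :=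
  have : Finite (CodeTree X F) := by unfold CodeTree; infer_instance
  Fintype.ofFinite _

/-- Mutual information, in bits, of a pair with joint probability mass function `p` on a product of
two finite sets (`0 log 0 = 0`). -/
noncomputable def mutualInfo {α β : Type*} [Fintype α] [Fintype β] (p : α → β → ℝ) : ℝ :=
  ∑ a, ∑ b, p a b * Real.logb 2 (p a b / ((∑ b', p a b') * (∑ a', p a' b)))

/-- Time is `(block, position in the block)`; `Before s t` is the chronological order. -/
def Before {m L : ℕ} (s t : Fin m × Fin L) : Prop :=
  s.1 < t.1 ∨ (s.1 = t.1 ∧ s.2 < t.2)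

/-- Code functions (adaptive codewords) for `m` blocks: the input at time `t` is a function of all
the feedback letters received before time `t`, in the same block and in earlier blocks. -/
def CodeFunction {L : ℕ} (X F : Fin L → Type*) (m : ℕ) : Type _ :=
  ∀ t : Fin m × Fin L, ((s : {s : Fin m × Fin L // Before s t}) → F s.1.2) → X t.2

/-- A code with `M` messages for `m` blocks, that is, for `m * L` channel uses. -/
structure PtpCode {L : ℕ} (X Y F : Fin L → Type*) (m M : ℕ) where
  /-- the code function of each message -/
  enc : Fin M → CodeFunction X F m
  /-- the decoding function -/
  dec : ((t : Fin m × Fin L) → Y t.2) → Fin M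

namespace PtpChannel

variable {L : ℕ} {X Y F : Fin L → Type*} {Z : Type*} [MeasurableSpace Z]

/-- The channel inputs produced by the code function `a` when the noise of block `b` is `z b`. -/
def inputs (C : PtpChannel X Y F Z) {m : ℕ} (a : CodeFunction X F m) (z : Fin m → Z)
    (t : Fin m × Fin L) : X t.2 :=
  a t fun s => C.fb s.1.2 (fun j => C.inputs a z (s.1.1, j)) (z s.1.1)
termination_by (t.1.val, t.2.val)
decreasing_by
  obtain ⟨⟨b, i⟩, hs⟩ := s
  obtain ⟨j, hj⟩ := j
  obtain ⟨b', i'⟩ := t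
  simp only [Set.mem_Iic] at hj
  rcases hs with h | ⟨h, h'⟩
  · exact Prod.Lex.left _ _ h
  · simp only at h h'
    subst h
    exact Prod.Lex.right _ (lt_of_le_of_lt hj h')

/-- The receiver outputs when the code function `a` is used and the noise of block `b` is `z b`. -/
def outputs (C : PtpChannel X Y F Z) {m : ℕ} (a : CodeFunction X F m) (z : Fin m → Z)
    (t : Fin m × Fin L) : Y t.2 :=
  C.out t.2 (fun j => C.inputs a z (t.1, j)) (z t.1)

/-- The error probability of a code: the message is uniform, the noises of the blocks are
independent with law `C.noise`, and message and noises are independent. -/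
noncomputable def errorProb (C : PtpChannel X Y F Z) {m M : ℕ} (c : PtpCode X Y F m M) : ℝ :=
  (∑ w : Fin M, (Measure.pi fun _ : Fin m => (C.noise : Measure Z)).real
    {z | c.dec (C.outputs (c.enc w) z) ≠ w}) / M

/-- `R` is achievable if, for every `ε > 0`, there are a number `m ≥ 1` of blocks and a code for
these `m * L` channel uses whose rate is `R` bits per channel use and whose error probability is
at most `ε`. -/
def Achievable (C : PtpChannel X Y F Z) (R : ℝ) : Prop :=
  ∀ ε : ℝ, 0 < ε → ∃ m M : ℕ, 0 < m ∧ 0 < M ∧ ∃ c : PtpCode X Y F m M,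
    R = Real.logb 2 M / (m * L) ∧ C.errorProb c ≤ ε

/-- The capacity region: the closure of the set of achievable rates. -/
def capacityRegion (C : PtpChannel X Y F Z) : Set ℝ :=
  closure {R | C.Achievable R}

/-- The capacity: the supremum of the capacity region. -/
noncomputable def capacity (C : PtpChannel X Y F Z) : ℝ :=
  sSup C.capacityRegion

/-- The causally conditioned channel law `P(y^L, f^L ‖ x^L)`: the probability that the outputs of
one block are `y` and `f` when its inputs are held fixed at `x`. -/
noncomputable def law (C : PtpChannel X Y F Z) (x : ∀ i, X i) (y : ∀ i, Y i) (f : ∀ i, F i) : ℝ :=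
  (C.noise : Measure Z).real
    {z | ∀ i, C.out i (fun j => x j) z = y i ∧ C.fb i (fun j => x j) z = f i}

open Classical in
/-- The joint distribution
`P(a^L, x^L, y^L, f^L) = P(a^L) 1(x^L ‖ a^L, 0 f^(L-1)) P(y^L, f^L ‖ x^L)`. -/
noncomputable def joint (C : PtpChannel X Y F Z) (P : CodeTree X F → ℝ)
    (a : CodeTree X F) (x : ∀ i, X i) (y : ∀ i, Y i) (f : ∀ i, F i) : ℝ :=
  P a * (if ∀ i, x i = a i (fun j => f j) then 1 else 0) * C.law x y f

/-- `I(A^L; Y^L)` in bits when the code tree `A^L` has probability mass function `P`. -/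
noncomputable def treeInfo (C : PtpChannel X Y F Z) [∀ i, Fintype (X i)] [∀ i, Fintype (Y i)]
    [∀ i, Fintype (F i)] (P : CodeTree X F → ℝ) : ℝ :=
  mutualInfo fun (a : CodeTree X F) (y : ∀ i, Y i) => ∑ x, ∑ f, C.joint P a x y f

end PtpChannel

/-! Inside one block a code function acts as a code tree selected by the feedback of earlier blocks,
and the noises of the blocks are independent. Each block is thus one use of a memoryless channel
from trees to outputs (`treeChannel`), and the claim is that its Shannon capacity, divided by `L`,
is the answer: noisy feedback across blocks does not help.

Converse. Let `P` maximise the information `I` and let `q` be its output law. The Kuhn-Tucker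
condition `rowDiv_le_of_isMax` says that no tree has an output law with divergence from `q` above
`I`. Compare the true law of outputs and feedback with a reference in which the outputs are i.i.d.
`q` whatever the message, while the feedback keeps its conditional law given tree and output. By
causality the divergence over `m` blocks is at most `m * I` (`neg_mul_le_of_causal`). Under the
reference the outputs carry no information about the message, which gives the Fano bound
`log_card_le_of_error_le`.

Direct part. Feinstein's greedy choice (`exists_codewords`) and Chebyshev's inequality give good
codes whose letters are trees, used without feedback from block to block. They reach every rational
multiple of `1 / L` below the bound, and the closure fills the interval. -/

/-! ### Mutual information and the Kuhn-Tucker condition at a maximiser. -/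

section Information

open Real Filter Topology

variable {α β : Type*} [Fintype α] [Fintype β]

/-- The output distribution of the channel `W` with input distribution `P`. -/
noncomputable def outDist (W : α → β → ℝ) (P : α → ℝ) (y : β) : ℝ := ∑ a, P a * W a y

/-- The divergence, in nats, of the output law `W a` from `q`. -/
noncomputable def rowDiv (W : α → β → ℝ) (q : β → ℝ) (a : α) : ℝ :=
  ∑ y, W a y * log (W a y / q y)

/-- The mutual information, in nats, between input and output of the channel `W`. -/
noncomputable def chanInfo (W : α → β → ℝ) (P : α → ℝ) : ℝ :=
  ∑ a, P a * rowDiv W (outDist W P) a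

/-- Each row of `W` is a probability mass function. -/
structure IsStochastic (W : α → β → ℝ) : Prop where
  nonneg : ∀ a y, 0 ≤ W a y
  sum_eq_one : ∀ a, ∑ y, W a y = 1

theorem outDist_nonneg {W : α → β → ℝ} (hW : IsStochastic W) {P : α → ℝ} (hP : P ∈ stdSimplex ℝ α)
    (y : β) : 0 ≤ outDist W P y :=
  Finset.sum_nonneg fun a _ => mul_nonneg (hP.1 a) (hW.nonneg a y)

theorem le_outDist {W : α → β → ℝ} (hW : IsStochastic W) {P : α → ℝ} (hP : P ∈ stdSimplex ℝ α)
    (a : α) (y : β) : P a * W a y ≤ outDist W P y :=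
  Finset.single_le_sum (f := fun a => P a * W a y)
    (fun a _ => mul_nonneg (hP.1 a) (hW.nonneg a y)) (Finset.mem_univ a)

theorem sum_outDist {W : α → β → ℝ} (hW : IsStochastic W) {P : α → ℝ} (hP : P ∈ stdSimplex ℝ α) :
    ∑ y, outDist W P y = 1 := by
  unfold outDist
  rw [Finset.sum_comm]
  simp [← Finset.mul_sum, hW.sum_eq_one, hP.2]

theorem mutualInfo_eq_chanInfo {W : α → β → ℝ} (hW : IsStochastic W) (P : α → ℝ) :
    mutualInfo (fun a y => P a * W a y) = chanInfo W P / log 2 := by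
  unfold mutualInfo chanInfo rowDiv
  rw [Finset.sum_div]
  refine Finset.sum_congr rfl fun a _ => ?_
  rw [Finset.mul_sum, Finset.sum_div]
  refine Finset.sum_congr rfl fun y _ => ?_
  rw [← Finset.mul_sum, hW.sum_eq_one, mul_one]
  rcases eq_or_ne (P a) 0 with h | h
  · simp [h]
  · rw [mul_div_mul_left _ _ h, logb, outDist]
    ring

/-- The gap between the two sides is the divergence of the output law from `r`, which is nonnegative
by `log x ≤ x - 1`. -/
theorem chanInfo_le_sum_rowDiv {W : α → β → ℝ} (hW : IsStochastic W) {P : α → ℝ}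
    (hP : P ∈ stdSimplex ℝ α) {r : β → ℝ} (hr : ∀ y, 0 ≤ r y) (hr1 : ∑ y, r y = 1)
    (hrP : ∀ y, 0 < outDist W P y → 0 < r y) :
    chanInfo W P ≤ ∑ a, P a * rowDiv W r a := by
  have key : ∀ a y, P a * (W a y * log (W a y / outDist W P y)) ≤
      P a * (W a y * log (W a y / r y)) - P a * W a y + P a * W a y * (r y / outDist W P y) := by
    intro a y
    rcases (mul_nonneg (hP.1 a) (hW.nonneg a y)).eq_or_lt with h | h
    · have h' : ∀ c, P a * (W a y * c) = 0 := fun c => by rw [← mul_assoc, ← h, zero_mul]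
      rw [h', h', ← h]
      simp
    · have hq := h.trans_le (le_outDist hW hP a y)
      have hr' := hrP y hq
      have hw : 0 < W a y := pos_of_mul_pos_right h (hP.1 a)
      rw [log_div hw.ne' hq.ne', log_div hw.ne' hr'.ne']
      have := log_le_sub_one_of_pos (div_pos hr' hq)
      rw [log_div hr'.ne' hq.ne'] at this
      nlinarith [mul_le_mul_of_nonneg_left this h.le]
  have hsum : ∑ a, ∑ y, P a * W a y = 1 := by
    simp [← Finset.mul_sum, hW.sum_eq_one, hP.2]
  have hsum' : ∑ a, ∑ y, P a * W a y * (r y / outDist W P y) ≤ 1 := by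
    rw [Finset.sum_comm, ← hr1]
    refine Finset.sum_le_sum fun y _ => ?_
    rw [← Finset.sum_mul]
    change outDist W P y * _ ≤ _
    rcases eq_or_ne (outDist W P y) 0 with h | h
    · simp [h, hr y]
    · rw [mul_div_cancel₀ _ h]
  have hle := Finset.sum_le_sum fun a (_ : a ∈ Finset.univ) =>
    Finset.sum_le_sum fun y (_ : y ∈ Finset.univ) => key a y
  simp only [Finset.sum_add_distrib, Finset.sum_sub_distrib] at hle
  simp only [chanInfo, rowDiv, Finset.mul_sum]
  linarith

theorem continuousOn_chanInfo {W : α → β → ℝ} (hW : IsStochastic W) :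
    ContinuousOn (chanInfo W) (stdSimplex ℝ α) := by
  have hq : ∀ y, Continuous fun P : α → ℝ => outDist W P y := fun y => by
    unfold outDist
    fun_prop
  -- Splitting the logarithm as output entropy minus conditional entropy leaves only `x log x`,
  -- continuous also at zero.
  have h : Continuous fun P : α → ℝ => ∑ a, P a * (∑ y, W a y * log (W a y)) -
      ∑ y, outDist W P y * log (outDist W P y) := by
    refine Continuous.sub (by fun_prop) (continuous_finsetSum _ fun y _ => ?_)
    exact continuous_mul_log.comp (hq y)
  refine h.continuousOn.congr fun P hP => ?_
  have h1 : ∑ y, outDist W P y * log (outDist W P y) =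
      ∑ a, ∑ y, P a * W a y * log (outDist W P y) := by
    rw [Finset.sum_comm]
    exact Finset.sum_congr rfl fun y _ => by rw [← Finset.sum_mul, outDist]
  dsimp only
  rw [chanInfo, h1, ← Finset.sum_sub_distrib]
  refine Finset.sum_congr rfl fun a _ => ?_
  rw [rowDiv, Finset.mul_sum, Finset.mul_sum, ← Finset.sum_sub_distrib]
  refine Finset.sum_congr rfl fun y _ => ?_
  rcases (mul_nonneg (hP.1 a) (hW.nonneg a y)).eq_or_lt with h | h
  · have h' : ∀ c, P a * (W a y * c) = 0 := fun c => by rw [← mul_assoc, ← h, zero_mul]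
    rw [h', h', ← h]
    simp
  · have hq := h.trans_le (le_outDist hW hP a y)
    have hw : 0 < W a y := pos_of_mul_pos_right h (hP.1 a)
    rw [log_div hw.ne' hq.ne']
    ring

theorem exists_isMaxOn_chanInfo [Nonempty α] {W : α → β → ℝ} (hW : IsStochastic W) :
    ∃ P ∈ stdSimplex ℝ α, ∀ P' ∈ stdSimplex ℝ α, chanInfo W P' ≤ chanInfo W P := by
  classical
  obtain ⟨a⟩ := ‹Nonempty α›
  exact (isCompact_stdSimplex ℝ α).exists_isMaxOn ⟨_, single_mem_stdSimplex ℝ a⟩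
    (continuousOn_chanInfo hW)

/-- Moving mass from a maximiser towards the letter `a` does not increase the information. -/
theorem rowDiv_perturb_le {W : α → β → ℝ} (hW : IsStochastic W) {P : α → ℝ}
    (hP : P ∈ stdSimplex ℝ α) (hmax : ∀ P' ∈ stdSimplex ℝ α, chanInfo W P' ≤ chanInfo W P)
    (a : α) {t : ℝ} (ht : 0 < t) (ht1 : t < 1) :
    rowDiv W (fun y => (1 - t) * outDist W P y + t * W a y) a ≤ chanInfo W P := by
  classical
  set r : β → ℝ := fun y => (1 - t) * outDist W P y + t * W a y with hr
  set P' : α → ℝ := (1 - t) • P + t • Pi.single a 1 with hP'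
  have hmem : P' ∈ stdSimplex ℝ α :=
    convex_stdSimplex ℝ α hP (single_mem_stdSimplex ℝ a) (by linarith) ht.le (by ring)
  have hlin : ∀ g : α → ℝ, ∑ b, P' b * g b = (1 - t) * ∑ b, P b * g b + t * g a := by
    intro g
    have : ∀ b, P' b * g b = (1 - t) * (P b * g b) + t * (if b = a then g b else 0) := by
      intro b
      by_cases hb : b = a
      · subst hb
        simp [hP']
        ring
      · simp [hP', hb]
        ring
    simp only [this, Finset.sum_add_distrib, ← Finset.mul_sum]
    simp
  have hout : outDist W P' = r := funext fun y => by
    rw [outDist, hlin fun b => W b y]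
    rfl
  -- The information of the mixture `P'` is `(1 - t)` times the average of `rowDiv W r` under `P`,
  -- plus `t * rowDiv W r a`. The average is at least the information of `P` (`h2`), so maximality
  -- bounds the second term.
  have h1 := hmax P' hmem
  rw [chanInfo, hout, hlin] at h1
  have hq0 := outDist_nonneg hW hP
  have h2 : chanInfo W P ≤ ∑ b, P b * rowDiv W r b := by
    refine chanInfo_le_sum_rowDiv hW hP (fun y => ?_) ?_ fun y hy => ?_
    · rw [← hout]
      exact outDist_nonneg hW hmem y
    · rw [← hout]
      exact sum_outDist hW hmem
    · have := mul_pos (sub_pos.2 ht1) hy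
      have := mul_nonneg ht.le (hW.nonneg a y)
      simp only [hr]
      linarith
  have h3 := mul_le_mul_of_nonneg_left h2 (sub_pos.2 ht1).le
  nlinarith

theorem sum_neg_log_le {W : α → β → ℝ} (hW : IsStochastic W) {P : α → ℝ}
    (hP : P ∈ stdSimplex ℝ α) (hmax : ∀ P' ∈ stdSimplex ℝ α, chanInfo W P' ≤ chanInfo W P)
    (a : α) {t : ℝ} (ht : 0 < t) (ht1 : t < 1) :
    ∑ y, W a y * -log ((1 - t) * outDist W P y + t * W a y) ≤
      chanInfo W P - ∑ y, W a y * log (W a y) := by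
  rw [le_sub_iff_add_le, ← Finset.sum_add_distrib]
  refine le_of_eq_of_le (Finset.sum_congr rfl fun y _ => ?_)
    (rowDiv_perturb_le hW hP hmax a ht ht1)
  rcases (hW.nonneg a y).eq_or_lt with h | h
  · simp [← h]
  · have : 0 < (1 - t) * outDist W P y + t * W a y :=
      add_pos_of_nonneg_of_pos
        (mul_nonneg (sub_pos.2 ht1).le (outDist_nonneg hW hP y)) (mul_pos ht h)
    rw [log_div h.ne' this.ne']
    ring

/-- An output reachable from `a` but missed by `P` would make the divergence of the mixture blow up
like `-log t` as `t → 0`, against the fixed bound of `sum_neg_log_le`. Without this, `log (x / 0) =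
0` would make `rowDiv` meaningless. -/
theorem outDist_pos_of_isMax {W : α → β → ℝ} (hW : IsStochastic W) {P : α → ℝ}
    (hP : P ∈ stdSimplex ℝ α) (hmax : ∀ P' ∈ stdSimplex ℝ α, chanInfo W P' ≤ chanInfo W P)
    (a : α) (y : β) (hy : 0 < W a y) : 0 < outDist W P y := by
  by_contra hq
  replace hq : outDist W P y = 0 := le_antisymm (not_lt.1 hq) (outDist_nonneg hW hP y)
  have hout1 : ∀ v, outDist W P v ≤ 1 := fun v => by
    rw [← sum_outDist hW hP]
    exact Finset.single_le_sum (f := outDist W P) (fun v _ => outDist_nonneg hW hP v)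
      (Finset.mem_univ v)
  have hW1 : ∀ v, W a v ≤ 1 := fun v => by
    rw [← hW.sum_eq_one a]
    exact Finset.single_le_sum (fun v _ => hW.nonneg a v) (Finset.mem_univ v)
  set K := chanInfo W P - ∑ y, W a y * log (W a y)
  have hb : ∀ t : ℝ, 0 < t → t < 1 → W a y * -log (t * W a y) ≤ K := by
    intro t ht ht1
    refine le_trans ?_ (sum_neg_log_le hW hP hmax a ht ht1)
    -- The mixture is at most 1, so all terms are nonnegative and the one at `y` can be singled out.
    have := Finset.single_le_sum
      (f := fun v => W a v * -log ((1 - t) * outDist W P v + t * W a v)) (s := Finset.univ)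
      (fun v _ => mul_nonneg (hW.nonneg a v) (neg_nonneg.2 (log_nonpos
        (add_nonneg (mul_nonneg (sub_pos.2 ht1).le (outDist_nonneg hW hP v))
          (mul_nonneg ht.le (hW.nonneg a v)))
        (by nlinarith [hout1 v, hW1 v, mul_le_mul_of_nonneg_left (hout1 v) (sub_pos.2 ht1).le])))) (Finset.mem_univ y)
    simpa [hq] using this
  have hlim : Tendsto (fun t : ℝ => W a y * -log (t * W a y)) (𝓝[>] 0) atTop := by
    refine Tendsto.const_mul_atTop hy (tendsto_neg_atBot_atTop.comp
      (tendsto_log_nhdsGT_zero.comp ?_))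
    refine tendsto_nhdsWithin_iff.2 ⟨?_, ?_⟩
    · have : Tendsto (fun t : ℝ => t * W a y) (𝓝 0) (𝓝 (0 * W a y)) := by
        exact tendsto_id.mul_const _
      rw [zero_mul] at this
      exact this.mono_left nhdsWithin_le_nhds
    · filter_upwards [self_mem_nhdsWithin] with t ht
      exact mul_pos ht hy
  obtain ⟨t, ⟨h1, ht⟩, h2⟩ := ((hlim.eventually_gt_atTop K).and
    (Ioo_mem_nhdsGT (show (0 : ℝ) < 1 by norm_num))).exists.imp fun t h => And.intro (And.intro h.1 h.2.1) h.2.2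
  exact absurd (hb t ht h2) (not_le.2 h1)

/-- Let `t → 0` in `rowDiv_perturb_le`; positivity of the output law on the support of the row makes
every term converge. -/
theorem rowDiv_le_of_isMax {W : α → β → ℝ} (hW : IsStochastic W) {P : α → ℝ}
    (hP : P ∈ stdSimplex ℝ α) (hmax : ∀ P' ∈ stdSimplex ℝ α, chanInfo W P' ≤ chanInfo W P)
    (a : α) : rowDiv W (outDist W P) a ≤ chanInfo W P := by
  have hlim : Tendsto (fun t : ℝ => rowDiv W (fun y => (1 - t) * outDist W P y + t * W a y) a)
      (𝓝[>] 0) (𝓝 (rowDiv W (outDist W P) a)) := by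
    refine tendsto_finsetSum _ fun y _ => Tendsto.const_mul _ ?_
    rcases (hW.nonneg a y).eq_or_lt with h | h
    · simp [← h]
    · have hq := outDist_pos_of_isMax hW hP hmax a y h
      have h1 : Tendsto (fun t : ℝ => (1 - t) * outDist W P y + t * W a y) (𝓝[>] 0)
          (𝓝 (outDist W P y)) := by
        have : Continuous fun t : ℝ => (1 - t) * outDist W P y + t * W a y := by fun_prop
        simpa using (this.tendsto 0).mono_left (nhdsWithin_le_nhds (s := Set.Ioi 0))
      exact (Tendsto.div tendsto_const_nhds h1 hq.ne').log (div_pos h hq).ne'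
  refine le_of_tendsto hlim ?_
  filter_upwards [Ioo_mem_nhdsGT (show (0 : ℝ) < 1 by norm_num)] with t ht
  exact rowDiv_perturb_le hW hP hmax a ht.1 ht.2

end Information

/-! ### Converse: change of measure under causal feedback. -/

section Converse

open Real

variable {α β φ σ : Type*}

theorem sum_fin_succ_fun [Fintype σ] {R : Type*} [AddCommMonoid R] {m : ℕ} (H : (Fin (m + 1) → σ) → R) :
    ∑ s, H s = ∑ x, ∑ s : Fin m → σ, H (Fin.cons x s) := by
  rw [← (Fin.consEquiv fun _ => σ).sum_comp, Fintype.sum_prod_type]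
  rfl

/-- A choice of letters that depends, at each time, only on the past. -/
def IsCausal {m : ℕ} (G : (Fin m → σ) → Fin m → α) : Prop :=
  ∀ s s' b, (∀ i < b, s i = s' i) → G s b = G s' b

theorem IsCausal.tail {m : ℕ} {G : (Fin (m + 1) → σ) → Fin (m + 1) → α} (hG : IsCausal G) (x : σ) :
    IsCausal fun (s : Fin m → σ) b => G (Fin.cons x s) b.succ := by
  intro s s' b h
  refine hG _ _ _ fun i => Fin.cases (fun _ => rfl) (fun i hi => ?_) i
  simpa using h i (Fin.succ_lt_succ_iff.1 hi)

theorem IsCausal.head {m : ℕ} {G : (Fin (m + 1) → σ) → Fin (m + 1) → α} (hG : IsCausal G)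
    (s s' : Fin (m + 1) → σ) : G s 0 = G s' 0 :=
  hG _ _ _ fun i hi => absurd hi (Fin.not_lt_zero i)

/-- Induction that peels off the first letter: its choice is a constant, and once it is fixed the
rest is again causal. -/
theorem sum_prod_causal_le [Fintype σ] [Nonempty σ] {m : ℕ} {G : (Fin m → σ) → Fin m → α} (hG : IsCausal G)
    (K : Fin m → α → σ → ℝ) (c : Fin m → ℝ) (hK : ∀ b a s, 0 ≤ K b a s)
    (hc : ∀ b a, ∑ s, K b a s ≤ c b) (hc0 : ∀ b, 0 ≤ c b) :
    ∑ s, ∏ b, K b (G s b) (s b) ≤ ∏ b, c b := by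
  induction m with
  | zero => simp
  | succ m ih =>
    rw [sum_fin_succ_fun, Fin.prod_univ_succ]
    obtain ⟨x₀⟩ := ‹Nonempty σ›
    calc _ = ∑ x, K 0 (G (fun _ => x₀) 0) x * ∑ s : Fin m → σ, ∏ b : Fin m,
          K b.succ (G (Fin.cons x s) b.succ) (s b) := by
          refine Finset.sum_congr rfl fun x _ => ?_
          rw [Finset.mul_sum]
          refine Finset.sum_congr rfl fun s _ => ?_
          rw [Fin.prod_univ_succ, hG.head _ fun _ => x₀]
          simp
      _ ≤ ∑ x, K 0 (G (fun _ => x₀) 0) x * ∏ b : Fin m, c b.succ := by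
          refine Finset.sum_le_sum fun x _ => mul_le_mul_of_nonneg_left ?_ (hK _ _ _)
          exact ih (hG.tail x) (fun b => K b.succ) (fun b => c b.succ) (fun b => hK _)
            (fun b => hc _) fun b => hc0 _
      _ ≤ _ := by
          rw [← Finset.sum_mul]
          exact mul_le_mul_of_nonneg_right (hc _ _) (Finset.prod_nonneg fun b _ => hc0 _)

theorem sum_prod_causal_eq_one [Fintype σ] [Nonempty σ] {m : ℕ} {G : (Fin m → σ) → Fin m → α} (hG : IsCausal G)
    (K : α → σ → ℝ) (hc : ∀ a, ∑ s, K a s = 1) :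
    ∑ s, ∏ b, K (G s b) (s b) = 1 := by
  induction m with
  | zero => simp
  | succ m ih =>
    rw [sum_fin_succ_fun]
    obtain ⟨x₀⟩ := ‹Nonempty σ›
    calc _ = ∑ x, K (G (fun _ => x₀) 0) x * ∑ s : Fin m → σ, ∏ b : Fin m,
          K (G (Fin.cons x s) b.succ) (s b) := by
          refine Finset.sum_congr rfl fun x _ => ?_
          rw [Finset.mul_sum]
          refine Finset.sum_congr rfl fun s _ => ?_
          rw [Fin.prod_univ_succ, hG.head _ fun _ => x₀]
          simp
      _ = ∑ x, K (G (fun _ => x₀) 0) x := by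
          refine Finset.sum_congr rfl fun x _ => ?_
          rw [ih (hG.tail x), mul_one]
      _ = 1 := hc _

/-- The chain rule for divergence: given the past, each block adds at most `I`. -/
theorem sum_prod_causal_mul_sum_le [Fintype σ] [Nonempty σ] {m : ℕ}
    {G : (Fin m → σ) → Fin m → α} (hG : IsCausal G) (K : α → σ → ℝ) (h : α → σ → ℝ) {I : ℝ}
    (hK : ∀ a s, 0 ≤ K a s) (hc : ∀ a, ∑ s, K a s = 1) (hI : ∀ a, ∑ s, K a s * h a s ≤ I) :
    ∑ s, (∏ b, K (G s b) (s b)) * ∑ b, h (G s b) (s b) ≤ m * I := by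
  induction m with
  | zero => simp
  | succ m ih =>
    rw [sum_fin_succ_fun]
    obtain ⟨x₀⟩ := ‹Nonempty σ›
    set a := G (fun _ => x₀) 0
    calc _ = ∑ x, K a x * (h a x * (∑ s : Fin m → σ, ∏ b : Fin m,
            K (G (Fin.cons x s) b.succ) (s b)) + ∑ s : Fin m → σ, (∏ b : Fin m,
            K (G (Fin.cons x s) b.succ) (s b)) *
              ∑ b : Fin m, h (G (Fin.cons x s) b.succ) (s b)) := by
          refine Finset.sum_congr rfl fun x _ => ?_
          rw [Finset.mul_sum, ← Finset.sum_add_distrib, Finset.mul_sum]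
          refine Finset.sum_congr rfl fun s _ => ?_
          rw [Fin.prod_univ_succ, Fin.sum_univ_succ, hG.head _ fun _ => x₀]
          simp only [Fin.cons_zero, Fin.cons_succ]
          ring
      _ ≤ ∑ x, K a x * (h a x + m * I) := by
          refine Finset.sum_le_sum fun x _ => mul_le_mul_of_nonneg_left ?_ (hK _ _)
          rw [sum_prod_causal_eq_one (hG.tail x) K hc, mul_one]
          exact add_le_add_right (ih (hG.tail x)) _
      _ ≤ _ := by
          simp only [mul_add, Finset.sum_add_distrib, ← Finset.sum_mul, hc]
          push_cast
          linarith [hI a]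

/-- A change-of-measure bound for one message: `r` is an arbitrary positive weight. -/
theorem neg_mul_le_of_causal [Fintype β] [Fintype φ] [Nonempty β] [Nonempty φ]
    {J : α → β → φ → ℝ} (hJ : ∀ a y f, 0 ≤ J a y f) (hJ1 : ∀ a, ∑ y, ∑ f, J a y f = 1)
    {q : β → ℝ} (hq : ∀ y, 0 ≤ q y) (hqpos : ∀ a y, 0 < ∑ f, J a y f → 0 < q y) {I : ℝ}
    (hI : ∀ a, rowDiv (fun a y => ∑ f, J a y f) q a ≤ I) {m : ℕ}
    {G : (Fin m → φ) → Fin m → α} (hG : IsCausal G) {r : (Fin m → β) → ℝ} (hr : ∀ y, 0 < r y) :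
    -(m * I) ≤ ∑ y : Fin m → β, (∏ b, q (y b)) * r y - 1 -
      ∑ s : Fin m → β × φ, (∏ b, J (G (fun b => (s b).2) b) (s b).1 (s b).2) *
        log (r fun b => (s b).1) := by
  set W : α → β → ℝ := fun a y => ∑ f, J a y f with hWdef
  have hW0 : ∀ a y, 0 ≤ W a y := fun a y => Finset.sum_nonneg fun f _ => hJ a y f
  have hJW : ∀ a y f, J a y f ≤ W a y := fun a y f =>
    Finset.single_le_sum (fun f _ => hJ a y f) (Finset.mem_univ f)
  have hG' : IsCausal fun (s : Fin m → β × φ) => G fun b => (s b).2 := fun s s' b h =>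
    hG _ _ _ fun i hi => by rw [h i hi]
  have h0 := sum_prod_causal_eq_one hG' (fun a s => J a s.1 s.2)
    (fun a => by rw [Fintype.sum_prod_type]; exact hJ1 a)
  have h1 := sum_prod_causal_mul_sum_le hG' (fun a s => J a s.1 s.2)
    (fun a s => log (W a s.1 / q s.1)) (fun a s => hJ _ _ _)
    (fun a => by rw [Fintype.sum_prod_type]; exact hJ1 a)
    (fun a => by
      rw [Fintype.sum_prod_type]
      simp only [← Finset.sum_mul]
      exact hI a)
  -- For a fixed output sequence, the reference weight sums over the feedback to at most the product
  -- of the `q (y b)`, whatever the code function does.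
  have h2 : ∑ s : Fin m → β × φ, (∏ b, J (G (fun b => (s b).2) b) (s b).1 (s b).2 /
      W (G (fun b => (s b).2) b) (s b).1 * q (s b).1) * r (fun b => (s b).1) ≤
      ∑ y : Fin m → β, (∏ b, q (y b)) * r y := by
    rw [← (Equiv.arrowProdEquivProdArrow (Fin m) (fun _ => β) fun _ => φ).symm.sum_comp,
      Fintype.sum_prod_type]
    refine Finset.sum_le_sum fun y _ => ?_
    change ∑ f : Fin m → φ, (∏ b, J (G f b) (y b) (f b) / W (G f b) (y b) * q (y b)) * r y ≤ _
    rw [← Finset.sum_mul]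
    refine mul_le_mul_of_nonneg_right ?_ (hr y).le
    refine sum_prod_causal_le hG (fun b a f => J a (y b) f / W a (y b) * q (y b))
      (fun b => q (y b)) (fun b a f => mul_nonneg (div_nonneg (hJ _ _ _) (hW0 _ _)) (hq _))
      (fun b a => ?_) fun b => hq _
    rw [← Finset.sum_mul, ← Finset.sum_div]
    -- Only an inequality, since the quotient is 0 where `W` vanishes.
    exact mul_le_of_le_one_left (hq _) (div_self_le_one _)
  have key : ∀ s : Fin m → β × φ,
      -((∏ b, J (G (fun b => (s b).2) b) (s b).1 (s b).2) *
        ∑ b, log (W (G (fun b => (s b).2) b) (s b).1 / q (s b).1)) ≤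
      (∏ b, J (G (fun b => (s b).2) b) (s b).1 (s b).2 /
        W (G (fun b => (s b).2) b) (s b).1 * q (s b).1) * r (fun b => (s b).1) -
      (∏ b, J (G (fun b => (s b).2) b) (s b).1 (s b).2) -
      (∏ b, J (G (fun b => (s b).2) b) (s b).1 (s b).2) * log (r fun b => (s b).1) := by
    intro s
    set a := G fun b => (s b).2
    set u := ∏ b, q (s b).1 / W (a b) (s b).1 with hu
    have hsplit : ∏ b, J (a b) (s b).1 (s b).2 / W (a b) (s b).1 * q (s b).1 =
        (∏ b, J (a b) (s b).1 (s b).2) * u := by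
      rw [hu, ← Finset.prod_mul_distrib]
      exact Finset.prod_congr rfl fun b _ => by ring
    rw [hsplit]
    rcases (Finset.prod_nonneg fun b (_ : b ∈ Finset.univ) =>
      hJ (a b) (s b).1 (s b).2).eq_or_lt with h | h
    · rw [← h]
      simp
    · have hJpos : ∀ b, 0 < J (a b) (s b).1 (s b).2 := fun b =>
        (hJ _ _ _).lt_of_ne' fun h' => h.ne' (Finset.prod_eq_zero (Finset.mem_univ b) h')
      have hWpos := fun b => (hJpos b).trans_le (hJW _ _ _)
      have hqp := fun b => hqpos _ _ (hWpos b)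
      have hu0 : 0 < u := Finset.prod_pos fun b _ => div_pos (hqp b) (hWpos b)
      have hlog : log u = -∑ b, log (W (a b) (s b).1 / q (s b).1) := by
        rw [hu, log_prod (fun b _ => (div_pos (hqp b) (hWpos b)).ne'), ← Finset.sum_neg_distrib]
        exact Finset.sum_congr rfl fun b _ => by rw [← log_inv, inv_div]
      -- `u` is the likelihood ratio of the reference to the true law.
      have h3 := log_le_sub_one_of_pos (mul_pos hu0 (hr fun b => (s b).1))
      rw [log_mul hu0.ne' (hr _).ne', hlog] at h3
      nlinarith [mul_le_mul_of_nonneg_left h3 h.le]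
  have h4 := Finset.sum_le_sum fun s (_ : s ∈ Finset.univ) => key s
  simp only [Finset.sum_sub_distrib, Finset.sum_neg_distrib] at h4
  linarith

/-- Fano-type bound for codes over a channel with causal, possibly noisy feedback. -/
theorem log_card_le_of_error_le [Fintype β] [Fintype φ] [Nonempty β] [Nonempty φ]
    {J : α → β → φ → ℝ} (hJ : ∀ a y f, 0 ≤ J a y f) (hJ1 : ∀ a, ∑ y, ∑ f, J a y f = 1)
    {q : β → ℝ} (hq : ∀ y, 0 ≤ q y) (hq1 : ∑ y, q y = 1)
    (hqpos : ∀ a y, 0 < ∑ f, J a y f → 0 < q y) {I : ℝ}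
    (hI : ∀ a, rowDiv (fun a y => ∑ f, J a y f) q a ≤ I) {m M : ℕ} (hM : 0 < M)
    {G : Fin M → (Fin m → φ) → Fin m → α} (hG : ∀ w, IsCausal (G w))
    (dec : (Fin m → β) → Fin M) {ε : ℝ} (hε : 0 < ε) (hε1 : ε < 1)
    (herr : (∑ w, ∑ s : Fin m → β × φ with dec (fun b => (s b).1) ≠ w,
      ∏ b, J (G w (fun b => (s b).2) b) (s b).1 (s b).2) / M ≤ ε) :
    (1 - ε) * log M ≤ m * I + ε - ε * log ε := by
  have hM' : (0 : ℝ) < M := by exact_mod_cast hM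
  set p : Fin M → (Fin m → β × φ) → ℝ := fun w s =>
    ∏ b, J (G w (fun b => (s b).2) b) (s b).1 (s b).2 with hp
  set e : Fin M → ℝ := fun w => ∑ s with dec (fun b => (s b).1) ≠ w, p w s with he
  have hp1 : ∀ w, ∑ s, p w s = 1 := fun w =>
    sum_prod_causal_eq_one (G := fun s : Fin m → β × φ => G w fun b => (s b).2)
      (fun s s' b h => hG w _ _ _ fun i hi => by rw [h i hi]) (fun a s => J a s.1 s.2)
      (fun a => by rw [Fintype.sum_prod_type]; exact hJ1 a)
  have hw : ∀ w, -(m * I) ≤ ∑ y : Fin m → β, (∏ b, q (y b)) * (if dec y = w then (M : ℝ) else ε)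
      - 1 - ((1 - e w) * log M + e w * log ε) := by
    intro w
    refine (neg_mul_le_of_causal hJ hJ1 hq hqpos hI (hG w)
      -- Weight `M` on a correct decision and `ε` on an error: summed over the messages, every
      -- output sequence gets at most `M * (1 + ε)`, and the logarithms yield `log M` and `log ε`.
      (r := fun y => if dec y = w then (M : ℝ) else ε)
      (fun y => by split_ifs <;> assumption)).trans_eq ?_
    congr 1
    have h1 : 1 - e w = ∑ s with dec (fun b => (s b).1) = w, p w s := by
      rw [← hp1 w, ← Finset.sum_filter_add_sum_filter_not _ fun s => dec (fun b => (s b).1) = w]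
      simp [he]
    rw [← Finset.sum_filter_add_sum_filter_not _ fun s : Fin m → β × φ =>
      dec (fun b => (s b).1) = w, h1, he, Finset.sum_mul, Finset.sum_mul]
    congr 1
    · refine Finset.sum_congr rfl fun s hs => ?_
      rw [if_pos (Finset.mem_filter.1 hs).2]
    · refine Finset.sum_congr rfl fun s hs => ?_
      rw [if_neg (Finset.mem_filter.1 hs).2]
  have hsum := Finset.sum_le_sum fun w (_ : w ∈ Finset.univ) => hw w
  have hprod : ∑ y : Fin m → β, ∏ b, q (y b) = 1 := by
    rw [← Fintype.prod_sum fun (_ : Fin m) y => q y]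
    simp [hq1]
  have hcol : ∑ w : Fin M, ∑ y : Fin m → β, (∏ b, q (y b)) * (if dec y = w then (M : ℝ) else ε) ≤
      M * (1 + ε) := by
    rw [Finset.sum_comm]
    calc _ ≤ ∑ y : Fin m → β, (∏ b, q (y b)) * (M * (1 + ε)) := by
          refine Finset.sum_le_sum fun y _ => ?_
          rw [← Finset.mul_sum]
          refine mul_le_mul_of_nonneg_left ?_ (Finset.prod_nonneg fun b _ => hq _)
          calc _ ≤ ∑ w : Fin M, ((if dec y = w then (M : ℝ) else 0) + ε) := by
                refine Finset.sum_le_sum fun w _ => ?_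
                split_ifs <;> linarith
            _ = _ := by
                simp [Finset.sum_add_distrib]
                ring
      _ = _ := by rw [← Finset.sum_mul, hprod, one_mul]
  set E := ∑ w, e w with hE
  have hEle : E ≤ ε * M := by
    rwa [div_le_iff₀ hM'] at herr
  simp only [Finset.sum_sub_distrib, Finset.sum_add_distrib, ← Finset.sum_mul, ← hE,
    Finset.sum_const, Finset.card_univ, Fintype.card_fin, nsmul_eq_mul, mul_one] at hsum
  have hlogε := log_neg hε hε1
  have hlogM : 0 ≤ log M := log_nonneg (by exact_mod_cast hM)
  refine le_of_mul_le_mul_left ?_ hM'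
  nlinarith [mul_le_mul_of_nonneg_right hEle hlogM,
    mul_le_mul_of_nonneg_right hEle (neg_nonneg.2 hlogε.le)]

end Converse

/-! ### Direct part: Feinstein's lemma and Chebyshev's inequality. -/

section DirectPart

open Real Filter Topology

theorem IsStochastic.pow {α β : Type*} [Fintype β] {W : α → β → ℝ} (hW : IsStochastic W) (m : ℕ) :
    IsStochastic fun (u : Fin m → α) (y : Fin m → β) => ∏ b, W (u b) (y b) where
  nonneg _ _ := Finset.prod_nonneg fun _ _ => hW.nonneg _ _
  sum_eq_one u := by
    rw [← Fintype.prod_sum fun b y => W (u b) y]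
    simp [hW.sum_eq_one]

theorem outDist_pow {α β : Type*} [Fintype α] (W : α → β → ℝ) (P : α → ℝ) {m : ℕ} (y : Fin m → β) :
    outDist (fun (u : Fin m → α) (y : Fin m → β) => ∏ b, W (u b) (y b))
      (fun u => ∏ b, P (u b)) y = ∏ b, outDist W P (y b) := by
  simp only [outDist, ← Finset.prod_mul_distrib]
  rw [← Fintype.prod_sum fun b a => P a * W a (y b)]

variable {α β σ : Type*} [Fintype α] [Fintype β] [Fintype σ]

/-- Mean and variance of an i.i.d. sum, in one induction because the cross term of the square needs
the mean. -/
theorem sum_prod_mul_sum_sq (p h : σ → ℝ) (hp1 : ∑ x, p x = 1) (hph : ∑ x, p x * h x = 0) (m : ℕ) :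
    ∑ s : Fin m → σ, (∏ b, p (s b)) * ∑ b, h (s b) = 0 ∧
    ∑ s : Fin m → σ, (∏ b, p (s b)) * (∑ b, h (s b)) ^ 2 = m * ∑ x, p x * h x ^ 2 := by
  induction m with
  | zero => simp
  | succ m ih =>
    have h1 : ∑ s : Fin m → σ, ∏ b, p (s b) = 1 := by
      rw [← Fintype.prod_sum fun (_ : Fin m) x => p x]
      simp [hp1]
    rw [sum_fin_succ_fun, sum_fin_succ_fun]
    simp only [Fin.prod_univ_succ, Fin.sum_univ_succ, Fin.cons_zero, Fin.cons_succ]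
    constructor
    · calc _ = ∑ x, (p x * h x * (∑ s : Fin m → σ, ∏ b, p (s b)) +
            p x * ∑ s : Fin m → σ, (∏ b, p (s b)) * ∑ b, h (s b)) := by
            refine Finset.sum_congr rfl fun x _ => ?_
            rw [Finset.mul_sum, Finset.mul_sum, ← Finset.sum_add_distrib]
            exact Finset.sum_congr rfl fun s _ => by ring
        _ = _ := by simp [h1, ih.1, hph]
    · calc _ = ∑ x, (p x * h x ^ 2 * (∑ s : Fin m → σ, ∏ b, p (s b)) +
            2 * (p x * h x) * (∑ s : Fin m → σ, (∏ b, p (s b)) * ∑ b, h (s b)) +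
            p x * ∑ s : Fin m → σ, (∏ b, p (s b)) * (∑ b, h (s b)) ^ 2) := by
            refine Finset.sum_congr rfl fun x _ => ?_
            rw [Finset.mul_sum, Finset.mul_sum, Finset.mul_sum, ← Finset.sum_add_distrib,
              ← Finset.sum_add_distrib]
            exact Finset.sum_congr rfl fun s _ => by ring
        _ = _ := by
            simp only [h1, ih.1, ih.2, mul_one, mul_zero, add_zero, Finset.sum_add_distrib,
              ← Finset.sum_mul, hp1, one_mul]
            push_cast
            ring

/-- Chebyshev's inequality for the lower tail of a sum of i.i.d. centred variables. -/
theorem sum_prod_filter_le (p h : σ → ℝ) (hp : ∀ x, 0 ≤ p x) (hp1 : ∑ x, p x = 1)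
    (hph : ∑ x, p x * h x = 0) {m : ℕ} {δ : ℝ} (hδ : 0 < δ) (hm : 0 < m) :
    ∑ s : Fin m → σ with ∑ b, h (s b) ≤ -(m * δ), ∏ b, p (s b) ≤
      (∑ x, p x * h x ^ 2) / δ ^ 2 / m := by
  have hm' : (0 : ℝ) < m := by exact_mod_cast hm
  have hpos : 0 < m * δ := mul_pos hm' hδ
  have hp' : ∀ s : Fin m → σ, 0 ≤ ∏ b, p (s b) := fun s => Finset.prod_nonneg fun b _ => hp _
  have h1 : (∑ s : Fin m → σ with ∑ b, h (s b) ≤ -(m * δ), ∏ b, p (s b)) * (m * δ) ^ 2 ≤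
      m * ∑ x, p x * h x ^ 2 := by
    rw [← (sum_prod_mul_sum_sq p h hp1 hph m).2, Finset.sum_mul]
    refine (Finset.sum_le_sum fun s hs => ?_).trans (Finset.sum_le_sum_of_subset_of_nonneg
      (Finset.filter_subset _ _) fun s _ _ => mul_nonneg (hp' s) (sq_nonneg _))
    refine mul_le_mul_of_nonneg_left ?_ (hp' s)
    have := (Finset.mem_filter.1 hs).2
    nlinarith
  rw [← le_div_iff₀ (by positivity)] at h1
  refine h1.trans_eq ?_
  field_simp

/-- Feinstein's lemma: a greedy choice of codewords with disjoint decoding sets. -/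
theorem exists_codewords {W : α → β → ℝ} (hW : IsStochastic W) {P : α → ℝ}
    (hP : P ∈ stdSimplex ℝ α) {γ η : ℝ} (hγ : 0 < γ) (M : ℕ)
    (h : ∑ a, P a * ∑ y with W a y < γ * outDist W P y, W a y + M / γ ≤ η) :
    ∃ (c : Fin M → α) (B : Fin M → Finset β), (∀ w w', w ≠ w' → Disjoint (B w) (B w')) ∧
      ∀ w, 1 - η ≤ ∑ y ∈ B w, W (c w) y := by
  classical
  suffices H : ∀ k ≤ M, ∃ (c : Fin k → α) (B : Fin k → Finset β),
      (∀ w w', w ≠ w' → Disjoint (B w) (B w')) ∧ (∀ w, 1 - η ≤ ∑ y ∈ B w, W (c w) y) ∧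
      ∀ w, ∀ y ∈ B w, γ * outDist W P y ≤ W (c w) y by
    obtain ⟨c, B, h1, h2, -⟩ := H M le_rfl
    exact ⟨c, B, h1, h2⟩
  intro k
  induction k with
  | zero => exact fun _ => ⟨Fin.elim0, Fin.elim0, fun w => w.elim0, fun w => w.elim0,
      fun w => w.elim0⟩
  | succ k ih =>
    intro hk
    obtain ⟨c, B, hdisj, hB, hT⟩ := ih (by omega)
    set D := Finset.univ.biUnion B with hD
    -- On its decoding set a codeword's likelihood is at least `γ` times the output law, so each set
    -- has output mass at most `1 / γ`.
    have hQD : ∑ y ∈ D, outDist W P y ≤ M / γ := by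
      rw [hD, Finset.sum_biUnion fun w _ w' _ hne => hdisj w w' hne]
      calc _ ≤ ∑ w : Fin k, 1 / γ := by
            refine Finset.sum_le_sum fun w _ => ?_
            rw [le_div_iff₀ hγ, ← hW.sum_eq_one (c w), mul_comm, Finset.mul_sum]
            exact (Finset.sum_le_sum (hT w)).trans (Finset.sum_le_sum_of_subset_of_nonneg
              (Finset.subset_univ _) fun y _ _ => hW.nonneg _ _)
        _ = k / γ := by simp [div_eq_mul_inv]
        _ ≤ _ := by
            have : (k : ℝ) ≤ M := by exact_mod_cast (by omega : k ≤ M)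
            gcongr
    -- If no letter could extend the code, averaging over `P` would contradict `h`.
    obtain ⟨a, ha⟩ : ∃ a, 1 - η ≤
        ∑ y ∈ (Finset.univ.filter fun y => γ * outDist W P y ≤ W a y) \ D, W a y := by
      by_contra! hcon
      have hrow : ∀ a, η - ∑ y ∈ D, W a y < ∑ y with W a y < γ * outDist W P y, W a y := by
        intro a
        have h1 := Finset.sum_filter_add_sum_filter_not Finset.univ
          (fun y => W a y < γ * outDist W P y) (W a)
        have h2 := Finset.sum_inter_add_sum_sdiff
          (Finset.univ.filter fun y => γ * outDist W P y ≤ W a y) D (W a)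
        have h3 : ∑ y ∈ (Finset.univ.filter fun y => γ * outDist W P y ≤ W a y) ∩ D, W a y ≤
            ∑ y ∈ D, W a y :=
          Finset.sum_le_sum_of_subset_of_nonneg Finset.inter_subset_right
            fun y _ _ => hW.nonneg a y
        simp only [not_lt] at h1
        linarith [hcon a, hW.sum_eq_one a]
      obtain ⟨a, ha⟩ : ∃ a, 0 < P a := by
        by_contra! h0
        have := Finset.sum_nonpos fun a (_ : a ∈ Finset.univ) => h0 a
        linarith [hP.2]
      have hlt : ∑ a, P a * (η - ∑ y ∈ D, W a y) <
          ∑ a, P a * ∑ y with W a y < γ * outDist W P y, W a y :=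
        Finset.sum_lt_sum (fun a _ => mul_le_mul_of_nonneg_left (hrow a).le (hP.1 a))
          ⟨a, Finset.mem_univ a, mul_lt_mul_of_pos_left (hrow a) ha⟩
      have hD' : ∑ a, P a * ∑ y ∈ D, W a y = ∑ y ∈ D, outDist W P y := by
        simp only [outDist, Finset.mul_sum]
        exact Finset.sum_comm
      simp only [mul_sub, Finset.sum_sub_distrib, ← Finset.sum_mul, hP.2, hD'] at hlt
      linarith
    refine ⟨Fin.snoc c a, Fin.snoc B
      ((Finset.univ.filter fun y => γ * outDist W P y ≤ W a y) \ D), ?_, ?_, ?_⟩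
    · have hsub : ∀ w, Disjoint (B w)
          ((Finset.univ.filter fun y => γ * outDist W P y ≤ W a y) \ D) := fun w =>
        Finset.disjoint_sdiff.mono_left (Finset.subset_biUnion_of_mem B (Finset.mem_univ w))
      intro w w'
      induction w using Fin.lastCases with
      | last =>
        induction w' using Fin.lastCases with
        | last => exact fun h => absurd rfl h
        | cast w' =>
          exact fun _ => by simpa only [Fin.snoc_last, Fin.snoc_castSucc] using (hsub w').symm
      | cast w =>
        induction w' using Fin.lastCases with
        | last => exact fun _ => by simpa only [Fin.snoc_last, Fin.snoc_castSucc] using hsub w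
        | cast w' =>
          intro hne
          simpa only [Fin.snoc_castSucc] using hdisj w w' fun h => hne (by rw [h])
    · intro w
      refine Fin.lastCases ?_ (fun w => ?_) w
      · simpa using ha
      · simpa using hB w
    · intro w
      refine Fin.lastCases ?_ (fun w => ?_) w
      · simp +contextual
      · simpa using hT w

theorem prod_mem_stdSimplex {P : α → ℝ} (hP : P ∈ stdSimplex ℝ α) (m : ℕ) :
    (fun u : Fin m → α => ∏ b, P (u b)) ∈ stdSimplex ℝ (Fin m → α) := by
  refine ⟨fun u => Finset.prod_nonneg fun _ _ => hP.1 _, ?_⟩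
  rw [← Fintype.prod_sum fun (_ : Fin m) a => P a]
  simp [hP.2]

/-- The probability that the information density of a block is small tends to zero. -/
theorem exists_sum_low_density_le {W : α → β → ℝ} (hW : IsStochastic W) {P : α → ℝ}
    (hP : P ∈ stdSimplex ℝ α) {δ : ℝ} (hδ : 0 < δ) : ∃ K : ℝ, ∀ m : ℕ, 0 < m →
    ∑ u : Fin m → α, (∏ b, P (u b)) * ∑ y : Fin m → β with ∏ b, W (u b) (y b) <
      exp (m * (chanInfo W P - δ)) * ∏ b, outDist W P (y b), ∏ b, W (u b) (y b) ≤ K / m := by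
  classical
  set I := chanInfo W P with hI
  set p : α × β → ℝ := fun x => P x.1 * W x.1 x.2 with hp
  set h : α × β → ℝ := fun x => log (W x.1 x.2 / outDist W P x.2) - I with hh
  have hp0 : ∀ x, 0 ≤ p x := fun x => mul_nonneg (hP.1 _) (hW.nonneg _ _)
  have hp1 : ∑ x, p x = 1 := by
    simp [hp, Fintype.sum_prod_type, ← Finset.mul_sum, hW.sum_eq_one, hP.2]
  have hph : ∑ x, p x * h x = 0 := by
    have h1 : ∑ x, p x * log (W x.1 x.2 / outDist W P x.2) = I := by
      simp only [hp, hI, Fintype.sum_prod_type, mul_assoc, ← Finset.mul_sum]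
      rfl
    simp only [hh, mul_sub, Finset.sum_sub_distrib, ← Finset.sum_mul, hp1, h1]
    ring
  refine ⟨(∑ x, p x * h x ^ 2) / δ ^ 2, fun m hm => ?_⟩
  refine le_trans ?_ (sum_prod_filter_le p h hp0 hp1 hph hδ hm)
  rw [Finset.sum_filter,
    ← (Equiv.arrowProdEquivProdArrow (Fin m) (fun _ => α) fun _ => β).symm.sum_comp,
    Fintype.sum_prod_type]
  refine Finset.sum_le_sum fun u _ => ?_
  rw [Finset.mul_sum, Finset.sum_filter]
  refine Finset.sum_le_sum fun y _ => ?_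
  change _ ≤ if ∑ b, h (u b, y b) ≤ -(m * δ) then ∏ b, p (u b, y b) else 0
  have hprod : ∏ b, p (u b, y b) = (∏ b, P (u b)) * ∏ b, W (u b) (y b) :=
    Finset.prod_mul_distrib
  rw [← hprod]
  have hnn : 0 ≤ ∏ b, p (u b, y b) := Finset.prod_nonneg fun b _ => hp0 _
  split_ifs with h1 h2 h2
  · exact le_rfl
  · rcases hnn.eq_or_lt with h0 | h0
    · exact h0.ge
    · refine absurd ?_ h2
      have hpp : ∀ b, 0 < p (u b, y b) := fun b =>
        (hp0 _).lt_of_ne' fun h' => h0.ne' (Finset.prod_eq_zero (Finset.mem_univ b) h')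
      have hWp : ∀ b, 0 < W (u b) (y b) := fun b => pos_of_mul_pos_right (hpp b) (hP.1 _)
      have hQp : ∀ b, 0 < outDist W P (y b) := fun b => (hpp b).trans_le (le_outDist hW hP _ _)
      have h3 := log_lt_log (Finset.prod_pos fun b _ => hWp b) h1
      rw [log_mul (exp_ne_zero _) (Finset.prod_pos fun b _ => hQp b).ne', log_exp,
        log_prod fun b _ => (hWp b).ne', log_prod fun b _ => (hQp b).ne'] at h3
      have h4 : ∑ b, h (u b, y b) = ∑ b, log (W (u b) (y b)) - ∑ b, log (outDist W P (y b)) -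
          m * I := by
        have h5 : ∀ b, h (u b, y b) = log (W (u b) (y b)) - log (outDist W P (y b)) - I :=
          fun b => by simp only [hh, log_div (hWp b).ne' (hQp b).ne']
        simp [h5, Finset.sum_sub_distrib]
      linarith
  · exact hnn
  · exact le_rfl

/-- The direct part of the coding theorem for a memoryless channel, with maximal error. -/
theorem exists_code_error_le {W : α → β → ℝ} (hW : IsStochastic W) {P : α → ℝ}
    (hP : P ∈ stdSimplex ℝ α) {R : ℝ} (hR : R < chanInfo W P) {ε : ℝ} (hε : 0 < ε) :
    ∃ N : ℕ, ∀ m : ℕ, N ≤ m → ∀ M : ℕ, 0 < M → log M ≤ m * R →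
      ∃ (c : Fin M → Fin m → α) (dec : (Fin m → β) → Fin M),
        ∀ w, ∑ y with dec y ≠ w, ∏ b, W (c w b) (y b) ≤ ε := by
  classical
  -- Half the gap: with threshold `γ = exp (m * (I - δ))`, where `I` is `chanInfo W P`, and `R = I -
  -- 2 * δ`, the term `M / γ` is at most `exp (-(m * δ))`.
  set δ := (chanInfo W P - R) / 2 with hδdef
  have hδ : 0 < δ := by linarith
  obtain ⟨K, hK⟩ := exists_sum_low_density_le hW hP hδ
  have h1 : Tendsto (fun m : ℕ => K / (m : ℝ) + exp (-(m * δ))) atTop (𝓝 (0 + 0)) := by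
    refine (tendsto_const_div_atTop_nhds_zero_nat K).add ?_
    refine tendsto_exp_atBot.comp (tendsto_neg_atTop_atBot.comp ?_)
    exact tendsto_natCast_atTop_atTop.atTop_mul_const hδ
  rw [add_zero] at h1
  obtain ⟨N, hN⟩ := eventually_atTop.1 ((h1.eventually_lt_const hε).and (eventually_gt_atTop 0))
  refine ⟨N, fun m hm M hM hMR => ?_⟩
  obtain ⟨hsmall, hm0⟩ := hN m hm
  obtain ⟨c, B, hdisj, hB⟩ := exists_codewords (hW.pow m) (prod_mem_stdSimplex hP m)
    (exp_pos (m * (chanInfo W P - δ))) (η := ε) M (by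
      simp only [outDist_pow]
      have h2 : (M : ℝ) / exp (m * (chanInfo W P - δ)) ≤ exp (-(m * δ)) := by
        rw [div_le_iff₀ (exp_pos _), ← exp_add, ← log_le_iff_le_exp (by exact_mod_cast hM)]
        refine hMR.trans_eq ?_
        rw [hδdef]
        ring
      linarith [hK m hm0])
  refine ⟨c, fun y => if h : ∃ w, y ∈ B w then h.choose else ⟨0, hM⟩, fun w => ?_⟩
  have h3 := (hW.pow m).sum_eq_one (c w)
  rw [← Finset.sum_sdiff (Finset.subset_univ (B w))] at h3
  have h4 : ∀ y ∈ B w, (if h : ∃ w, y ∈ B w then h.choose else ⟨0, hM⟩) = w := by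
    intro y hy
    have hex : ∃ w, y ∈ B w := ⟨w, hy⟩
    rw [dif_pos hex]
    by_contra hne
    exact Finset.disjoint_left.1 (hdisj _ _ hne) hex.choose_spec hy
  have h5 : ∑ y with (if h : ∃ w, y ∈ B w then h.choose else ⟨0, hM⟩) ≠ w,
      ∏ b, W (c w b) (y b) ≤ ∑ y ∈ Finset.univ \ B w, ∏ b, W (c w b) (y b) := by
    refine Finset.sum_le_sum_of_subset_of_nonneg (fun y hy => ?_)
      fun y _ _ => (hW.pow m).nonneg _ _
    simp only [Finset.mem_sdiff, Finset.mem_univ, true_and]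
    exact fun hyB => (Finset.mem_filter.1 hy).2 (h4 y hyB)
  linarith [hB w]

end DirectPart

/-! ### Reduction of block codes to code trees. -/

namespace PtpChannel

variable {L : ℕ} {X Y F : Fin L → Type*} {Z : Type*} [MeasurableSpace Z]

/-- The inputs selected by the code tree `a` when the feedback of the block is `f`. -/
def treeInputs (a : CodeTree X F) (f : ∀ i, F i) (i : Fin L) : X i := a i fun j => f j

/-- The joint law of the outputs and the feedback of one block in which the code tree `a` is
used. -/
noncomputable def treeLaw (C : PtpChannel X Y F Z) (a : CodeTree X F) (y : ∀ i, Y i)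
    (f : ∀ i, F i) : ℝ :=
  C.law (treeInputs a f) y f

/-- The code tree used in block `b` by the code function `a` when the feedback is `f`. -/
noncomputable def blockTree {m : ℕ} (a : CodeFunction X F m) (f : Fin m → ∀ i, F i) (b : Fin m) :
    CodeTree X F := fun i g => a (b, i) fun s =>
  if h : s.1.1 = b then g ⟨s.1.2, by
    rcases s.2 with h' | h'
    · exact absurd h h'.ne
    · exact h'.2⟩
  else f s.1.1 s.1.2

theorem isCausal_blockTree {m : ℕ} (a : CodeFunction X F m) : IsCausal (blockTree a) := by
  intro f f' b h
  funext i g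
  unfold blockTree
  congr 1
  funext s
  split_ifs with hs
  · rfl
  · rw [h s.1.1 (s.2.resolve_right fun h' => hs h'.1)]

theorem treeInputs_blockTree {m : ℕ} (a : CodeFunction X F m) (f : Fin m → ∀ i, F i) (b : Fin m)
    (i : Fin L) : treeInputs (blockTree a f b) (f b) i = a (b, i) fun s => f s.1.1 s.1.2 := by
  unfold treeInputs blockTree
  congr 1
  funext s
  split_ifs with hs
  · rw [hs]
  · rfl

/-- The code function that uses the code tree `u b` in block `b`. -/
def treeCode {m : ℕ} (u : Fin m → CodeTree X F) : CodeFunction X F m :=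
  fun t g => u t.1 t.2 fun j => g ⟨(t.1, j), Or.inr ⟨rfl, j.2⟩⟩

theorem blockTree_treeCode {m : ℕ} (u : Fin m → CodeTree X F) (f : Fin m → ∀ i, F i) :
    blockTree (treeCode u) f = u := by
  funext b i g
  simp [blockTree, treeCode]

/-- The feedback when the code function `a` is used and the noise of block `b` is `z b`. -/
def feedback (C : PtpChannel X Y F Z) {m : ℕ} (a : CodeFunction X F m) (z : Fin m → Z)
    (t : Fin m × Fin L) : F t.2 :=
  C.fb t.2 (fun j => C.inputs a z (t.1, j)) (z t.1)

theorem inputs_eq (C : PtpChannel X Y F Z) {m : ℕ} (a : CodeFunction X F m) (z : Fin m → Z)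
    (t : Fin m × Fin L) : C.inputs a z t = a t fun s => C.feedback a z s.1 := by
  rw [inputs]
  rfl

/-- The outputs and the feedback of all blocks. -/
def transcript (C : PtpChannel X Y F Z) {m : ℕ} (a : CodeFunction X F m) (z : Fin m → Z)
    (b : Fin m) : (∀ i, Y i) × (∀ i, F i) :=
  (fun i => C.outputs a z (b, i), fun i => C.feedback a z (b, i))

/-- A feedback sequence that the noise reproduces from the inputs it dictates is the actual one, by
recursion in chronological order. -/
theorem inputs_eq_of_fb_eq (C : PtpChannel X Y F Z) {m : ℕ} (a : CodeFunction X F m)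
    (z : Fin m → Z) (f : Fin m → ∀ i, F i)
    (h : ∀ b i, C.fb i (fun j => treeInputs (blockTree a f b) (f b) j) (z b) = f b i)
    (t : Fin m × Fin L) : C.inputs a z t = treeInputs (blockTree a f t.1) (f t.1) t.2 := by
  rw [treeInputs_blockTree, inputs]
  congr 1
  funext s
  rw [← h s.1.1 s.1.2]
  congr 1
  funext j
  exact inputs_eq_of_fb_eq C a z f h (s.1.1, j)
termination_by (t.1.val, t.2.val)
decreasing_by
  obtain ⟨⟨b, i⟩, hs⟩ := s
  obtain ⟨j, hj⟩ := j
  obtain ⟨b', i'⟩ := t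
  simp only [Set.mem_Iic] at hj
  rcases hs with h | ⟨h, h'⟩
  · exact Prod.Lex.left _ _ h
  · simp only at h h'
    subst h
    exact Prod.Lex.right _ (lt_of_le_of_lt hj h')

/-- Once the whole transcript is prescribed, so are the trees and inputs of every block, and the
event decouples into one condition on each `z b`. This is the source of the product law. -/
theorem transcript_eq_iff (C : PtpChannel X Y F Z) {m : ℕ} (a : CodeFunction X F m)
    (z : Fin m → Z) (s : Fin m → (∀ i, Y i) × (∀ i, F i)) :
    C.transcript a z = s ↔ ∀ b i,
      C.out i (fun j => treeInputs (blockTree a (fun b => (s b).2) b) (s b).2 j) (z b) =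
        (s b).1 i ∧
      C.fb i (fun j => treeInputs (blockTree a (fun b => (s b).2) b) (s b).2 j) (z b) =
        (s b).2 i := by
  constructor
  · rintro rfl b i
    have h : ∀ j, treeInputs (blockTree a (fun b => (C.transcript a z b).2) b)
        (C.transcript a z b).2 j = C.inputs a z (b, j) := fun j => by
      rw [inputs_eq]
      exact treeInputs_blockTree a (fun b => (C.transcript a z b).2) b j
    simp only [h]
    exact ⟨rfl, rfl⟩
  · intro h
    have hin := C.inputs_eq_of_fb_eq a z (fun b => (s b).2) fun b i => (h b i).2
    funext b
    refine Prod.ext (funext fun i => ?_) (funext fun i => ?_)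
    · rw [← (h b i).1]
      simp only [transcript, outputs, hin]
    · rw [← (h b i).2]
      simp only [transcript, feedback, hin]

theorem measurableSet_law (C : PtpChannel X Y F Z) (x : ∀ i, X i) (y : ∀ i, Y i) (f : ∀ i, F i) :
    MeasurableSet {z | ∀ i, C.out i (fun j => x j) z = y i ∧ C.fb i (fun j => x j) z = f i} := by
  simp only [Set.ofPred_forall]
  exact MeasurableSet.iInter fun i =>
    (C.measurableSet_out i _ _).inter (C.measurableSet_fb i _ _)

theorem transcript_preimage (C : PtpChannel X Y F Z) {m : ℕ} (a : CodeFunction X F m)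
    (s : Fin m → (∀ i, Y i) × (∀ i, F i)) :
    C.transcript a ⁻¹' {s} = Set.univ.pi fun b => {z | ∀ i,
      C.out i (fun j => treeInputs (blockTree a (fun b => (s b).2) b) (s b).2 j) z =
        (s b).1 i ∧
      C.fb i (fun j => treeInputs (blockTree a (fun b => (s b).2) b) (s b).2 j) z =
        (s b).2 i} := by
  ext z
  simp [transcript_eq_iff]

theorem measurableSet_transcript_preimage (C : PtpChannel X Y F Z) {m : ℕ}
    (a : CodeFunction X F m) (s : Fin m → (∀ i, Y i) × (∀ i, F i)) :
    MeasurableSet (C.transcript a ⁻¹' {s}) := by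
  rw [transcript_preimage]
  exact MeasurableSet.univ_pi fun b => C.measurableSet_law _ _ _

theorem measureReal_transcript_preimage (C : PtpChannel X Y F Z) {m : ℕ}
    (a : CodeFunction X F m) (s : Fin m → (∀ i, Y i) × (∀ i, F i)) :
    (Measure.pi fun _ : Fin m => (C.noise : Measure Z)).real (C.transcript a ⁻¹' {s}) =
      ∏ b, C.treeLaw (blockTree a (fun b => (s b).2) b) (s b).1 (s b).2 := by
  rw [transcript_preimage, measureReal_def, Measure.pi_pi, ENNReal.toReal_prod]
  rfl

theorem treeLaw_nonneg (C : PtpChannel X Y F Z) (a : CodeTree X F) (y : ∀ i, Y i)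
    (f : ∀ i, F i) : 0 ≤ C.treeLaw a y f := measureReal_nonneg

variable [∀ i, Fintype (Y i)] [∀ i, Fintype (F i)]

theorem measureReal_transcript (C : PtpChannel X Y F Z) {m : ℕ} (a : CodeFunction X F m)
    (p : (Fin m → (∀ i, Y i) × (∀ i, F i)) → Prop) [DecidablePred p] :
    (Measure.pi fun _ : Fin m => (C.noise : Measure Z)).real {z | p (C.transcript a z)} =
      ∑ s with p s, ∏ b, C.treeLaw (blockTree a (fun b => (s b).2) b) (s b).1 (s b).2 := by
  simp only [← measureReal_transcript_preimage]
  rw [sum_measureReal_preimage_singleton _ fun s _ => C.measurableSet_transcript_preimage a s]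
  simp [Set.preimage]

theorem sum_treeLaw (C : PtpChannel X Y F Z) (a : CodeTree X F) :
    ∑ y, ∑ f, C.treeLaw a y f = 1 := by
  -- The total probability for a single block.
  have h := C.measureReal_transcript (m := 1) (treeCode fun _ => a) fun _ => True
  simp only [blockTree_treeCode, Set.ofPred_true, probReal_univ, Finset.filter_true,
    Fin.prod_univ_one] at h
  rw [h, ← Fintype.sum_prod_type' (f := fun y f => C.treeLaw a y f)]
  exact (Fintype.sum_equiv (Equiv.funUnique (Fin 1) _) _ _ fun s => rfl).symm

/-- The channel from the code tree of a block to the receiver outputs of that block. -/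
noncomputable def treeChannel (C : PtpChannel X Y F Z) (a : CodeTree X F) (y : ∀ i, Y i) : ℝ :=
  ∑ f, C.treeLaw a y f

theorem isStochastic_treeChannel (C : PtpChannel X Y F Z) : IsStochastic C.treeChannel where
  nonneg a y := Finset.sum_nonneg fun f _ => C.treeLaw_nonneg a y f
  sum_eq_one := C.sum_treeLaw

theorem treeInfo_eq [∀ i, Fintype (X i)] (C : PtpChannel X Y F Z) (P : CodeTree X F → ℝ) :
    C.treeInfo P = chanInfo C.treeChannel P / Real.log 2 := by
  classical
  rw [← mutualInfo_eq_chanInfo C.isStochastic_treeChannel, treeInfo]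
  congr 1
  funext a y
  rw [treeChannel, Finset.mul_sum, Finset.sum_comm]
  refine Finset.sum_congr rfl fun f _ => ?_
  have : ∀ x : ∀ i, X i, C.joint P a x y f =
      if treeInputs a f = x then P a * C.treeLaw a y f else 0 := by
    intro x
    unfold joint
    by_cases h : treeInputs a f = x
    · subst h
      simp [treeInputs, treeLaw]
    · have h' : ¬ ∀ i, x i = a i fun j => f j := fun h' => h (funext fun i => (h' i).symm)
      simp [h, h']
  simp [this]

theorem errorProb_eq (C : PtpChannel X Y F Z) {m M : ℕ} (c : PtpCode X Y F m M) :
    C.errorProb c = (∑ w, ∑ s : Fin m → (∀ i, Y i) × (∀ i, F i) with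
      c.dec (fun t => (s t.1).1 t.2) ≠ w,
      ∏ b, C.treeLaw (blockTree (c.enc w) (fun b => (s b).2) b) (s b).1 (s b).2) / M := by
  unfold errorProb
  congr 1
  refine Finset.sum_congr rfl fun w _ => ?_
  exact C.measureReal_transcript (c.enc w) fun s => c.dec (fun t => (s t.1).1 t.2) ≠ w

end PtpChannel

instance CodeTree.instNonempty {L : ℕ} {X F : Fin L → Type*} [∀ i, Nonempty (X i)] : Nonempty (CodeTree X F) :=
  ⟨fun _ _ => Classical.arbitrary _⟩

/-! ### Achievable rates and the capacity. -/

namespace PtpChannel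

open Filter Topology

variable {L : ℕ} {X Y F : Fin L → Type*} {Z : Type*} [MeasurableSpace Z]

theorem Achievable.nonneg {C : PtpChannel X Y F Z} {R : ℝ} (h : C.Achievable R) : 0 ≤ R := by
  obtain ⟨m, M, -, hM, -, rfl, -⟩ := h 1 one_pos
  exact div_nonneg (Real.logb_nonneg one_lt_two (by exact_mod_cast hM)) (by positivity)

variable [∀ i, Fintype (Y i)] [∀ i, Fintype (F i)]

/-- An empty sum could not be the total probability 1. -/
theorem nonempty_outputs_feedback (C : PtpChannel X Y F Z) (a : CodeTree X F) :
    Nonempty ((∀ i, Y i) × (∀ i, F i)) := by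
  by_contra h
  rw [not_nonempty_iff] at h
  have := C.sum_treeLaw a
  rw [← Fintype.sum_prod_type' (f := fun y f => C.treeLaw a y f)] at this
  simp at this

theorem Achievable.le_info [∀ i, Fintype (X i)] [∀ i, Nonempty (X i)] {C : PtpChannel X Y F Z}
    (hL : 0 < L) {R : ℝ} (hR : C.Achievable R) {P : CodeTree X F → ℝ}
    (hP : P ∈ stdSimplex ℝ (CodeTree X F))
    (hmax : ∀ P' ∈ stdSimplex ℝ (CodeTree X F),
      chanInfo C.treeChannel P' ≤ chanInfo C.treeChannel P) :
    R ≤ C.treeInfo P / L := by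
  classical
  set I := chanInfo C.treeChannel P with hI
  have hW := C.isStochastic_treeChannel
  obtain ⟨a⟩ := CodeTree.instNonempty (X := X) (F := F)
  have hne := C.nonempty_outputs_feedback a
  have : Nonempty (∀ i, Y i) := ⟨hne.some.1⟩
  have : Nonempty (∀ i, F i) := ⟨hne.some.2⟩
  have hL' : (0 : ℝ) < L := by exact_mod_cast hL
  have hlog2 : 0 < Real.log 2 := Real.log_pos one_lt_two
  have hbound : ∀ ε : ℝ, 0 < ε → ε < 1 →
      (1 - ε) * (R * (L * Real.log 2)) ≤ I + (ε - ε * Real.log ε) := by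
    intro ε hε hε1
    obtain ⟨m, M, hm, hM, c, hRM, herr⟩ := hR ε hε
    have hm' : (1 : ℝ) ≤ m := by exact_mod_cast hm
    rw [errorProb_eq] at herr
    have h := log_card_le_of_error_le (J := C.treeLaw) C.treeLaw_nonneg C.sum_treeLaw
      (outDist_nonneg hW hP) (sum_outDist hW hP) (outDist_pos_of_isMax hW hP hmax)
      (rowDiv_le_of_isMax hW hP hmax) hM (fun w => isCausal_blockTree (c.enc w))
      (fun y => c.dec fun t => y t.1 t.2) hε hε1 herr
    have hRM' : Real.log M = m * (R * (L * Real.log 2)) := by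
      rw [hRM, Real.logb]
      field_simp
    rw [hRM'] at h
    -- Nonnegativity and `1 ≤ m` allow the Fano remainder to be multiplied by `m`, so that `m`
    -- cancels.
    have hnn : 0 ≤ ε - ε * Real.log ε := by nlinarith [Real.log_neg hε hε1]
    refine le_of_mul_le_mul_left ?_ (one_pos.trans_le hm')
    nlinarith
  have hlim1 : Tendsto (fun ε : ℝ => (1 - ε) * (R * (L * Real.log 2))) (𝓝[>] 0)
      (𝓝 (R * (L * Real.log 2))) := by
    have : Continuous fun ε : ℝ => (1 - ε) * (R * (L * Real.log 2)) := by fun_prop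
    simpa using (this.tendsto 0).mono_left (nhdsWithin_le_nhds (s := Set.Ioi 0))
  have hlim2 : Tendsto (fun ε : ℝ => I + (ε - ε * Real.log ε)) (𝓝[>] 0) (𝓝 I) := by
    have : Continuous fun ε : ℝ => I + (ε - ε * Real.log ε) :=
      continuous_const.add (continuous_id.sub Real.continuous_mul_log)
    simpa using (this.tendsto 0).mono_left (nhdsWithin_le_nhds (s := Set.Ioi 0))
  have h := le_of_tendsto_of_tendsto hlim1 hlim2 (by
    filter_upwards [Ioo_mem_nhdsGT (show (0 : ℝ) < 1 by norm_num)] with ε hε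
    exact hbound ε hε.1 hε.2)
  rw [treeInfo_eq, div_div, le_div_iff₀ (mul_pos hlog2 hL'), mul_comm (Real.log 2)]
  exact h

theorem achievable_of_lt [∀ i, Fintype (X i)] (C : PtpChannel X Y F Z) (hL : 0 < L)
    {P : CodeTree X F → ℝ} (hP : P ∈ stdSimplex ℝ (CodeTree X F)) {k n : ℕ} (hn : 0 < n)
    (h : (k : ℝ) / (n * L) < C.treeInfo P / L) : C.Achievable (k / (n * L)) := by
  classical
  intro ε hε
  have hL' : (0 : ℝ) < L := by exact_mod_cast hL
  have hn' : (0 : ℝ) < n := by exact_mod_cast hn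
  have hlog2 : 0 < Real.log 2 := Real.log_pos one_lt_two
  have hlt : (k / n : ℝ) * Real.log 2 < chanInfo C.treeChannel P := by
    rw [← lt_div_iff₀ hlog2, ← treeInfo_eq]
    rwa [← div_div, div_lt_div_iff_of_pos_right hL'] at h
  obtain ⟨N, hN⟩ := exists_code_error_le C.isStochastic_treeChannel hP hlt hε
  -- The factor `N + 1` makes the number of blocks at least `N` and positive while the rate stays
  -- exactly `k / (n * L)`.
  obtain ⟨c, dec, hc⟩ := hN (n * (N + 1)) (by nlinarith) (2 ^ (k * (N + 1))) (by positivity) (by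
    push_cast
    rw [Real.log_pow]
    push_cast
    apply le_of_eq
    field_simp)
  refine ⟨n * (N + 1), 2 ^ (k * (N + 1)), by positivity, by positivity,
    ⟨fun w => treeCode (c w), fun y => dec fun b i => y (b, i)⟩, ?_, ?_⟩
  · push_cast
    rw [← Real.rpow_natCast, Real.logb_rpow two_pos (by norm_num)]
    push_cast
    field_simp
  · rw [errorProb_eq]
    refine div_le_of_le_mul₀ (by positivity) hε.le ?_
    refine (Finset.sum_le_card_nsmul _ _ ε fun w _ => ?_).trans_eq (by simp [mul_comm])
    refine le_trans (le_of_eq ?_) (hc w)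
    simp only [blockTree_treeCode]
    rw [Finset.sum_filter, Finset.sum_filter,
      ← (Equiv.arrowProdEquivProdArrow (Fin (n * (N + 1))) (fun _ => ∀ i, Y i)
        fun _ => ∀ i, F i).symm.sum_comp, Fintype.sum_prod_type]
    refine Finset.sum_congr rfl fun y _ => ?_
    change ∑ f : Fin (n * (N + 1)) → ∀ i, F i,
      (if dec y ≠ w then ∏ b, C.treeLaw (c w b) (y b) (f b) else 0) = _
    split_ifs
    · simp only [treeChannel]
      rw [← Fintype.prod_sum fun b f => C.treeLaw (c w b) (y b) f]
    · simp

end PtpChannel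

theorem theorem2 {L : ℕ} (hL : 0 < L) {X Y F : Fin L → Type*}
    [∀ i, Fintype (X i)] [∀ i, Nonempty (X i)] [∀ i, Fintype (Y i)] [∀ i, Fintype (F i)]
    {Z : Type*} [MeasurableSpace Z] (C : PtpChannel X Y F Z) :
    C.capacityRegion = Set.Icc 0 C.capacity ∧
      IsGreatest ((fun P : CodeTree X F → ℝ => C.treeInfo P / L) '' stdSimplex ℝ (CodeTree X F))
        C.capacity := by
  obtain ⟨P, hP, hmax⟩ := exists_isMaxOn_chanInfo C.isStochastic_treeChannel
  have hL' : (0 : ℝ) < L := by exact_mod_cast hL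
  -- A single message is never decoded wrongly.
  have hzero : C.Achievable 0 := fun ε hε => ⟨1, 1, one_pos, one_pos,
    ⟨fun _ _ _ => Classical.arbitrary _, fun _ => 0⟩, by simp, by
      simpa [PtpChannel.errorProb, Subsingleton.elim _ (0 : Fin 1)] using hε.le⟩
  have h0 : 0 ≤ C.treeInfo P / L := hzero.le_info hL hP hmax
  have hregion : C.capacityRegion = Set.Icc 0 (C.treeInfo P / L) := by
    refine Set.Subset.antisymm
      (closure_minimal (fun R hR => ⟨hR.nonneg, hR.le_info hL hP hmax⟩) isClosed_Icc) ?_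
    -- The degenerate case is separate because `Set.Ioo 0 0` is empty and its closure misses 0.
    rcases h0.eq_or_lt with h | h
    · rw [← h, Set.Icc_self, Set.singleton_subset_iff]
      exact subset_closure hzero
    rw [← closure_Ioo h.ne]
    refine closure_minimal (fun R hR => ?_) isClosed_closure
    refine Metric.mem_closure_iff.2 fun η hη => ?_
    -- Achievability asks for the exact rate, so `R` is approximated by a rational multiple of `1 /
    -- L`.
    obtain ⟨r, hr1, hr2⟩ := exists_rat_btwn
      (mul_lt_mul_of_pos_right (lt_min hR.2 (lt_add_of_pos_right R hη)) hL')
    have hr0 : 0 ≤ r := by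
      have : (0 : ℝ) < r := (mul_pos hR.1 hL').trans hr1
      exact_mod_cast this.le
    have hr : (r : ℝ) / L = (r.num.toNat : ℝ) / (r.den * L) := by
      have hnum : ((r.num.toNat : ℤ) : ℝ) = (r.num : ℝ) := by
        rw [Int.toNat_of_nonneg (Rat.num_nonneg.2 hr0)]
      rw [← div_div]
      congr 1
      rw [← Int.cast_natCast (R := ℝ) r.num.toNat, hnum]
      exact Rat.cast_def r
    rw [← div_lt_iff₀ hL', lt_min_iff] at hr2
    rw [← lt_div_iff₀ hL'] at hr1
    refine ⟨r / L, ?_, ?_⟩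
    · rw [hr] at hr2 ⊢
      exact C.achievable_of_lt hL hP r.den_pos hr2.1
    · rw [Real.dist_eq, abs_lt]
      constructor <;> linarith [hr2.2]
  have hcap : C.capacity = C.treeInfo P / L := by
    rw [PtpChannel.capacity, hregion, csSup_Icc h0]
  rw [hcap]
  refine ⟨hregion, ⟨P, hP, rfl⟩, ?_⟩
  rintro _ ⟨P', hP', rfl⟩
  simp only [PtpChannel.treeInfo_eq]
  gcongr
  exact hmax P' hP'
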